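/- A (commutative) residuated lattice is an algebra $\mathbf{A}=\langle A;\cdot,\to,\wedge,\vee,e\rangle$ such that $\langle A;\cdot,e\rangle$ is a commutative monoid, $\langle A;\wedge,\vee\rangle$ is a lattice with order $\leqslant$, and $x\cdot y\leqslant z \iff y\leqslant x\to z$ for all $x,y,z\in A$. It is idempotent if $x\cdot x=x$ for all $x\in A$, and semilinear if it is isomorphic to a subdirect product of totally ordered residuated lattices. Write $x^{*}=x\to e$. A generalized Sugihara monoid is a semilinear idempotent residuated lattice that satisfies $(x\vee e)^{**}=x\vee e$. A variety is a class of similar algebras that is closed under homomorphic images, subalgebras and direct products. Theorem. Let $\mathcal{K}$ be a variety all of whose members are generalized Sugihara monoids. Then $\mathcal{K}$ has surjective epimorphisms: if $f\colon\mathbf{A}\to\mathbf{B}$ is a homomorphism between members of $\mathcal{K}$ such that, for every $\mathbf{C}\in\mathcal{K}$ and all homomorphisms $g,h\colon\mathbf{B}\to\mathbf{C}$, $g\circ f=h\circ f$ implies $g=h$, then $f$ is surjective. -/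

import Mathlib

universe u v

/-- A (commutative) residuated lattice `⟨A; *, →, ⊓, ⊔, 1⟩`, where the neutral element `e` is `1`
and the residual `x → y` is `res x y`. -/
class ResiduatedLattice (α : Type u) extends CommMonoid α, Lattice α where
  /-- the residual `x → y` -/
  res : α → α → α
  /-- the law of residuation -/
  residuation : ∀ x y z : α, x * y ≤ z ↔ y ≤ res x z

namespace ResiduatedLattice

/-- Homomorphisms of residuated lattices: maps preserving all five operations. -/
structure Hom (A : Type u) (B : Type v) [ResiduatedLattice A] [ResiduatedLattice B] where
  toFun : A → B
  map_one : toFun 1 = 1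
  map_mul : ∀ x y, toFun (x * y) = toFun x * toFun y
  map_res : ∀ x y, toFun (res x y) = res (toFun x) (toFun y)
  map_inf : ∀ x y, toFun (x ⊓ y) = toFun x ⊓ toFun y
  map_sup : ∀ x y, toFun (x ⊔ y) = toFun x ⊔ toFun y

instance (A : Type u) (B : Type v) [ResiduatedLattice A] [ResiduatedLattice B] :
    FunLike (Hom A B) A B where
  coe := Hom.toFun
  coe_injective := by
    rintro ⟨f, _, _, _, _, _⟩ ⟨g, _, _, _, _, _⟩ h
    cases h
    rfl

/-- The direct product of a family of residuated lattices, with pointwise operations. -/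
instance (ι : Type u) (A : ι → Type v) [∀ i, ResiduatedLattice (A i)] :
    ResiduatedLattice (∀ i, A i) where
  toCommMonoid := inferInstance
  toLattice := inferInstance
  res x y := fun i => res (x i) (y i)
  residuation x y z := forall_congr' fun i => residuation (x i) (y i) (z i)

/-- `A` is isomorphic to a subdirect product of totally ordered residuated lattices: it embeds into
a direct product of totally ordered algebras, and its image projects onto each factor. -/
def IsSemilinear (A : Type u) [ResiduatedLattice A] : Prop :=
  ∃ (ι : Type u) (C : ι → Type u) (_ : ∀ i, ResiduatedLattice (C i)),
    (∀ i, ∀ x y : C i, x ≤ y ∨ y ≤ x) ∧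
    ∃ φ : Hom A (∀ i, C i),
      Function.Injective φ ∧ ∀ i, Function.Surjective fun a => φ a i

/-- Every element is idempotent. -/
def IsIdempotent (A : Type u) [ResiduatedLattice A] : Prop :=
  ∀ x : A, x * x = x

/-- The operation `x* = x → e`. -/
def eStar {A : Type u} [ResiduatedLattice A] (x : A) : A := res x 1

/-- Generalized Sugihara monoids: the semilinear idempotent residuated lattices that satisfy
the identity `(x ∨ e)** = x ∨ e`. -/
structure IsGeneralizedSugiharaMonoid (A : Type u) [ResiduatedLattice A] : Prop where
  semilinear : IsSemilinear A
  idempotent : IsIdempotent A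
  star_star : ∀ x : A, eStar (eStar (x ⊔ 1)) = x ⊔ 1

end ResiduatedLattice

/-- Bundled residuated lattices. -/
structure RL : Type (u + 1) where
  carrier : Type u
  [inst : ResiduatedLattice carrier]

namespace RL

attribute [instance] RL.inst

/-- Homomorphisms between bundled residuated lattices. -/
abbrev Hom (A B : RL.{u}) : Type u := ResiduatedLattice.Hom A.carrier B.carrier

/-- The class of all generalized Sugihara monoids. -/
def GSM : Set RL.{u} :=
  {A | ResiduatedLattice.IsGeneralizedSugiharaMonoid A.carrier}

/-- A class of residuated lattices is a variety when it is closed under homomorphic images,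
(isomorphic copies of) subalgebras, and direct products of arbitrary, possibly empty, families. -/
structure IsVariety (K : Set RL.{u}) : Prop where
  homImage : ∀ {A B : RL.{u}} (f : Hom A B), Function.Surjective f → A ∈ K → B ∈ K
  subalgebra : ∀ {A B : RL.{u}} (f : Hom A B), Function.Injective f → B ∈ K → A ∈ K
  product : ∀ (ι : Type u) (A : ι → RL.{u}), (∀ i, A i ∈ K) →
    RL.mk (∀ i, (A i).carrier) ∈ K

/-- A homomorphism `f : A → B` is a `K`-epimorphism: homomorphisms from `B` into members of `K`
that agree after composition with `f` are equal. (Used for `A, B ∈ K`.) -/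
def IsEpi (K : Set RL.{u}) {A B : RL.{u}} (f : Hom A B) : Prop :=
  ∀ C ∈ K, ∀ g h : Hom B C, (∀ a, g (f a) = h (f a)) → g = h

/-- The epimorphism-surjectivity property: all `K`-epimorphisms between members of `K` are
surjective. -/
def HasES (K : Set RL.{u}) : Prop :=
  ∀ A ∈ K, ∀ B ∈ K, ∀ f : Hom A B, IsEpi K f → Function.Surjective f

end RL

/-! Suppose `f : A → B` is epic but misses `b`. Since `B` is a distributive lattice, two prime
lattice filters `U`, `V` separate `b` from the range of `f`: `b` lies in `U` but not in `V`, while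
range elements in `U` lie in `V`. Each prime filter is a union of classes of the congruence given by
its `stabilizer`, whose quotient is a chain by prelinearity. So it suffices to find one `f a`
congruent to `b` modulo both stabilizers.

Modulo a single stabilizer this is the chain case (`exists_hom_ne_of_chain`): a proper subalgebra of
a chain `X` is never epic in `X`. In a chain, products and residuals take values among `x`, `y` and
`x*`, so filters and subalgebras can be defined by cuts at a missing element; the identity `(x ∨
e)** = x ∨ e` controls `*`.

The two approximations are merged in `exists_proj_eq_of_surjective`: epicness forces them to agree
modulo the join of the pulled-back filters on `A`, and permutability of congruences yields a common
solution. -/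

namespace ResiduatedLattice

/-! ### Arithmetic of residuated lattices -/

section Basic

variable {A : Type u} [ResiduatedLattice A]

theorem mul_le_iff_le_res {x y z : A} : x * y ≤ z ↔ y ≤ res x z := residuation x y z

theorem mul_res_le (x y : A) : x * res x y ≤ y := mul_le_iff_le_res.2 le_rfl

theorem mul_le_mul_of_le_right (x : A) {y z : A} (h : y ≤ z) : x * y ≤ x * z :=
  mul_le_iff_le_res.2 (h.trans (mul_le_iff_le_res.1 le_rfl))

theorem mul_le_mul_of_le {x x' y y' : A} (hx : x ≤ x') (hy : y ≤ y') : x * y ≤ x' * y' := by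
  refine (mul_le_mul_of_le_right x hy).trans ?_
  rw [mul_comm x, mul_comm x']
  exact mul_le_mul_of_le_right y' hx

theorem mul_le_left_of_le_one {x y : A} (hy : y ≤ 1) : x * y ≤ x :=
  (mul_le_mul_of_le_right x hy).trans (mul_one x).le

theorem mul_le_right_of_le_one {x y : A} (hx : x ≤ 1) : x * y ≤ y :=
  mul_comm x y ▸ mul_le_left_of_le_one hx

theorem one_le_res_iff {x y : A} : 1 ≤ res x y ↔ x ≤ y := by
  rw [← mul_le_iff_le_res, mul_one]

theorem one_res (x : A) : res 1 x = x :=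
  le_antisymm (by simpa using mul_res_le 1 x) (mul_le_iff_le_res.1 (one_mul x).le)

theorem mul_sup_distrib (x y z : A) : x * (y ⊔ z) = x * y ⊔ x * z := by
  refine le_antisymm ?_ (sup_le (mul_le_mul_of_le_right x le_sup_left)
    (mul_le_mul_of_le_right x le_sup_right))
  exact mul_le_iff_le_res.2 (sup_le (mul_le_iff_le_res.1 le_sup_left)
    (mul_le_iff_le_res.1 le_sup_right))

theorem res_mul (x y z : A) : res (x * y) z = res y (res x z) := by
  refine eq_of_forall_le_iff fun w => ?_
  rw [← mul_le_iff_le_res, ← mul_le_iff_le_res, ← mul_le_iff_le_res, mul_assoc]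

theorem res_le_res {x x' y y' : A} (hx : x' ≤ x) (hy : y ≤ y') : res x y ≤ res x' y' :=
  mul_le_iff_le_res.1 (((mul_le_mul_of_le hx le_rfl).trans (mul_res_le x y)).trans hy)

theorem res_inf (x y z : A) : res x (y ⊓ z) = res x y ⊓ res x z := by
  refine eq_of_forall_le_iff fun w => ?_
  simp only [← mul_le_iff_le_res, le_inf_iff]

theorem sup_res (x y z : A) : res (x ⊔ y) z = res x z ⊓ res y z := by
  refine eq_of_forall_le_iff fun w => ?_
  simp only [le_inf_iff, ← mul_le_iff_le_res, mul_comm _ w, mul_sup_distrib, sup_le_iff]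

theorem res_mul_res_le (x y z : A) : res x y * res y z ≤ res x z := by
  rw [← mul_le_iff_le_res, ← mul_assoc]
  exact (mul_le_mul_of_le (mul_res_le x y) le_rfl).trans (mul_res_le y z)

theorem inf_one_mul_inf_one_le (x y : A) : (x ⊓ 1) * (y ⊓ 1) ≤ x ⊓ y :=
  le_inf ((mul_le_left_of_le_one inf_le_right).trans inf_le_left)
    ((mul_le_right_of_le_one inf_le_right).trans inf_le_left)

theorem eStar_anti {x y : A} (h : x ≤ y) : eStar y ≤ eStar x := res_le_res h le_rfl

theorem le_eStar_eStar (x : A) : x ≤ eStar (eStar x) :=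
  mul_le_iff_le_res.1 (mul_comm x (eStar x) ▸ mul_res_le x 1)

theorem one_le_eStar {x : A} (h : x ≤ 1) : 1 ≤ eStar x := one_le_res_iff.2 h

theorem eStar_le_one {x : A} (h : 1 ≤ x) : eStar x ≤ 1 :=
  (eStar_anti h).trans (one_res 1).le

/-- A Mal'cev term for residuated lattices. -/
def malcev (x y z : A) : A := res (res x y ⊓ 1) z ⊓ res (res z y ⊓ 1) x

theorem le_res_res_inf_one (x z : A) : z ≤ res (res z x ⊓ 1) x := by
  rw [← mul_le_iff_le_res, mul_comm]
  exact (mul_le_mul_of_le_right z inf_le_left).trans (mul_res_le z x)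

theorem res_self_inf_one (x : A) : res x x ⊓ 1 = 1 := inf_eq_right.2 (one_le_res_iff.2 le_rfl)

theorem malcev_left (x z : A) : malcev x x z = z := by
  rw [malcev, res_self_inf_one, one_res]
  exact inf_eq_left.2 (le_res_res_inf_one x z)

theorem malcev_right (x z : A) : malcev x z z = x := by
  rw [malcev, res_self_inf_one, one_res]
  exact inf_eq_right.2 (le_res_res_inf_one z x)

end Basic

/-! ### Homomorphisms -/

namespace Hom

variable {A B C : Type*} [ResiduatedLattice A] [ResiduatedLattice B] [ResiduatedLattice C]

@[simp] theorem apply_one (f : Hom A B) : f 1 = 1 := f.map_one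
@[simp] theorem apply_mul (f : Hom A B) (x y : A) : f (x * y) = f x * f y := f.map_mul x y
@[simp] theorem apply_res (f : Hom A B) (x y : A) : f (res x y) = res (f x) (f y) := f.map_res x y
@[simp] theorem apply_inf (f : Hom A B) (x y : A) : f (x ⊓ y) = f x ⊓ f y := f.map_inf x y
@[simp] theorem apply_sup (f : Hom A B) (x y : A) : f (x ⊔ y) = f x ⊔ f y := f.map_sup x y

@[simp] theorem apply_eStar (f : Hom A B) (x : A) : f (eStar x) = eStar (f x) := by
  simp [eStar]

@[simp] theorem apply_malcev (f : Hom A B) (x y z : A) :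
    f (malcev x y z) = malcev (f x) (f y) (f z) := by
  simp [malcev]

theorem monotone (f : Hom A B) {x y : A} (h : x ≤ y) : f x ≤ f y := by
  rw [← inf_eq_left] at h ⊢
  rw [← apply_inf, h]

/-- Composition of homomorphisms. -/
def comp (g : Hom B C) (f : Hom A B) : Hom A C where
  toFun x := g (f x)
  map_one := by simp
  map_mul := by simp
  map_res := by simp
  map_inf := by simp
  map_sup := by simp

@[simp] theorem comp_apply (g : Hom B C) (f : Hom A B) (x : A) : g.comp f x = g (f x) := rfl

theorem ext {f g : Hom A B} (h : ∀ x, f x = g x) : f = g := DFunLike.coe_injective (funext h)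

/-- A homomorphism factors through any surjective homomorphism with a smaller kernel. -/
theorem exists_factor (p : Hom A B) (hp : Function.Surjective p) (j : Hom A C)
    (hj : ∀ x y, p x = p y → j x = j y) : ∃ h : Hom B C, ∀ x, h (p x) = j x := by
  choose s hs using hp
  have key : ∀ x, j (s (p x)) = j x := fun x => hj _ _ (hs _)
  have hop : ∀ (op : A → A → A) (opB : B → B → B) (opC : C → C → C),
      (∀ x y, p (op x y) = opB (p x) (p y)) → (∀ x y, j (op x y) = opC (j x) (j y)) →
      ∀ x y, j (s (opB x y)) = opC (j (s x)) (j (s y)) := by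
    intro op opB opC h1 h2 x y
    rw [← h2]
    apply hj
    rw [hs, h1, hs, hs]
  refine ⟨⟨fun y => j (s y), ?_, ?_, ?_, ?_, ?_⟩, key⟩
  · rw [← apply_one p, key, apply_one]
  · exact hop _ _ _ p.map_mul j.map_mul
  · exact hop _ _ _ p.map_res j.map_res
  · exact hop _ _ _ p.map_inf j.map_inf
  · exact hop _ _ _ p.map_sup j.map_sup

end Hom

/-! ### Deductive filters, quotients and permutability -/

/-- Deductive filters: the upward closed submonoids that are closed under meets. -/
structure DeductiveFilter (A : Type u) [ResiduatedLattice A] where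
  carrier : Set A
  one_mem : 1 ∈ carrier
  mul_mem : ∀ {x y}, x ∈ carrier → y ∈ carrier → x * y ∈ carrier
  inf_mem : ∀ {x y}, x ∈ carrier → y ∈ carrier → x ⊓ y ∈ carrier
  upward : ∀ {x y}, x ≤ y → x ∈ carrier → y ∈ carrier

namespace DeductiveFilter

variable {A : Type u} [ResiduatedLattice A] (F : DeductiveFilter A)

theorem mem_of_one_le {x : A} (h : 1 ≤ x) : x ∈ F.carrier := F.upward h F.one_mem

/-- The congruence of a deductive filter. -/
def setoid : Setoid A where
  r x y := res x y ∈ F.carrier ∧ res y x ∈ F.carrier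
  iseqv :=
    { refl := fun _ => ⟨F.mem_of_one_le (one_le_res_iff.2 le_rfl),
        F.mem_of_one_le (one_le_res_iff.2 le_rfl)⟩
      symm := fun h => ⟨h.2, h.1⟩
      trans := fun h k => ⟨F.upward (res_mul_res_le _ _ _) (F.mul_mem h.1 k.1),
        F.upward (res_mul_res_le _ _ _) (F.mul_mem k.2 h.2)⟩ }

/-- The quotient of a residuated lattice by a deductive filter. -/
def Quot : Type u := Quotient F.setoid

/-- The class of an element. -/
def cls (x : A) : F.Quot := Quotient.mk F.setoid x

theorem cls_surjective : Function.Surjective F.cls := Quotient.mk_surjective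

variable {F}

theorem cls_eq_iff {x y : A} :
    F.cls x = F.cls y ↔ res x y ∈ F.carrier ∧ res y x ∈ F.carrier :=
  Quotient.eq (r := F.setoid)

theorem res_trans {x y z : A} (h : res x y ∈ F.carrier) (k : res y z ∈ F.carrier) :
    res x z ∈ F.carrier :=
  F.upward (res_mul_res_le _ _ _) (F.mul_mem h k)

theorem res_mem_of_le {x y : A} (h : x ≤ y) : res x y ∈ F.carrier :=
  F.mem_of_one_le (one_le_res_iff.2 h)

theorem res_mul_mem {x x' y y' : A} (h : res x x' ∈ F.carrier) (k : res y y' ∈ F.carrier) :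
    res (x * y) (x' * y') ∈ F.carrier := by
  refine F.upward (mul_le_iff_le_res.1 ?_) (F.mul_mem h k)
  rw [mul_mul_mul_comm]
  exact mul_le_mul_of_le (mul_res_le _ _) (mul_res_le _ _)

theorem res_res_mem {x x' y y' : A} (h : res x' x ∈ F.carrier) (k : res y y' ∈ F.carrier) :
    res (res x y) (res x' y') ∈ F.carrier := by
  refine F.upward (mul_le_iff_le_res.1 (mul_le_iff_le_res.1 ?_)) (F.mul_mem h k)
  calc x' * (res x y * (res x' x * res y y'))
      = x' * res x' x * res x y * res y y' := by ac_rfl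
    _ ≤ x * res x y * res y y' :=
        mul_le_mul_of_le (mul_le_mul_of_le (mul_res_le _ _) le_rfl) le_rfl
    _ ≤ y * res y y' := mul_le_mul_of_le (mul_res_le _ _) le_rfl
    _ ≤ y' := mul_res_le _ _

theorem res_inf_mem {x y z : A} (h : res x y ∈ F.carrier) (k : res x z ∈ F.carrier) :
    res x (y ⊓ z) ∈ F.carrier := by
  rw [res_inf]
  exact F.inf_mem h k

theorem sup_res_mem {x y z : A} (h : res x z ∈ F.carrier) (k : res y z ∈ F.carrier) :
    res (x ⊔ y) z ∈ F.carrier := by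
  rw [sup_res]
  exact F.inf_mem h k

instance : PartialOrder F.Quot where
  le := Quotient.lift₂ (fun x y => res x y ∈ F.carrier) fun x y x' y' hx hy =>
    propext ⟨fun h => res_trans hx.2 (res_trans h hy.1),
      fun h => res_trans hx.1 (res_trans h hy.2)⟩
  le_refl := by
    rintro ⟨x⟩
    exact res_mem_of_le (le_refl x)
  le_trans := by
    rintro ⟨x⟩ ⟨y⟩ ⟨z⟩ h k
    exact res_trans (x := x) (y := y) (z := z) h k
  le_antisymm := by
    rintro ⟨x⟩ ⟨y⟩ h k
    exact cls_eq_iff.2 ⟨h, k⟩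

instance : ResiduatedLattice F.Quot where
  mul := Quotient.map₂ (· * ·) fun _ _ hx _ _ hy =>
    ⟨res_mul_mem hx.1 hy.1, res_mul_mem hx.2 hy.2⟩
  one := F.cls 1
  mul_assoc := by
    rintro ⟨x⟩ ⟨y⟩ ⟨z⟩
    exact congrArg F.cls (mul_assoc x y z)
  one_mul := by
    rintro ⟨x⟩
    exact congrArg F.cls (one_mul x)
  mul_one := by
    rintro ⟨x⟩
    exact congrArg F.cls (mul_one x)
  mul_comm := by
    rintro ⟨x⟩ ⟨y⟩
    exact congrArg F.cls (mul_comm x y)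
  inf := Quotient.map₂ (· ⊓ ·) fun _ _ hx _ _ hy =>
    ⟨res_inf_mem (res_trans (res_mem_of_le inf_le_left) hx.1)
        (res_trans (res_mem_of_le inf_le_right) hy.1),
      res_inf_mem (res_trans (res_mem_of_le inf_le_left) hx.2)
        (res_trans (res_mem_of_le inf_le_right) hy.2)⟩
  sup := Quotient.map₂ (· ⊔ ·) fun _ _ hx _ _ hy =>
    ⟨sup_res_mem (res_trans hx.1 (res_mem_of_le le_sup_left))
        (res_trans hy.1 (res_mem_of_le le_sup_right)),
      sup_res_mem (res_trans hx.2 (res_mem_of_le le_sup_left))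
        (res_trans hy.2 (res_mem_of_le le_sup_right))⟩
  inf_le_left := by
    rintro ⟨x⟩ ⟨y⟩
    exact res_mem_of_le (inf_le_left : x ⊓ y ≤ x)
  inf_le_right := by
    rintro ⟨x⟩ ⟨y⟩
    exact res_mem_of_le (inf_le_right : x ⊓ y ≤ y)
  le_inf := by
    rintro ⟨x⟩ ⟨y⟩ ⟨z⟩ h k
    exact res_inf_mem (x := x) (y := y) (z := z) h k
  le_sup_left := by
    rintro ⟨x⟩ ⟨y⟩
    exact res_mem_of_le (le_sup_left : x ≤ x ⊔ y)
  le_sup_right := by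
    rintro ⟨x⟩ ⟨y⟩
    exact res_mem_of_le (le_sup_right : y ≤ x ⊔ y)
  sup_le := by
    rintro ⟨x⟩ ⟨y⟩ ⟨z⟩ h k
    exact sup_res_mem (x := x) (y := y) (z := z) h k
  res := Quotient.map₂ res fun _ _ hx _ _ hy =>
    ⟨res_res_mem hx.2 hy.1, res_res_mem hx.1 hy.2⟩
  residuation := by
    rintro ⟨x⟩ ⟨y⟩ ⟨z⟩
    change res (x * y) z ∈ F.carrier ↔ res y (res x z) ∈ F.carrier
    rw [res_mul]

variable (F) in
/-- The quotient homomorphism. -/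
def proj : Hom A F.Quot where
  toFun := F.cls
  map_one := rfl
  map_mul _ _ := rfl
  map_res _ _ := rfl
  map_inf _ _ := rfl
  map_sup _ _ := rfl

theorem proj_surjective : Function.Surjective F.proj := F.cls_surjective

theorem proj_eq_iff {x y : A} :
    F.proj x = F.proj y ↔ res x y ∈ F.carrier ∧ res y x ∈ F.carrier := cls_eq_iff

theorem proj_le_iff {x y : A} : F.proj x ≤ F.proj y ↔ res x y ∈ F.carrier := Iff.rfl

theorem proj_eq_one {x : A} (hx : x ≤ 1) : F.proj x = 1 ↔ x ∈ F.carrier := by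
  rw [← F.proj.apply_one, proj_eq_iff, one_res]
  exact and_iff_right (res_mem_of_le hx)

/-- The preimage of a deductive filter under a homomorphism. -/
def comap {B : Type v} [ResiduatedLattice B] (f : Hom A B) (G : DeductiveFilter B) :
    DeductiveFilter A where
  carrier := f ⁻¹' G.carrier
  one_mem := by simpa using G.one_mem
  mul_mem h k := by simpa using G.mul_mem h k
  inf_mem h k := by simpa using G.inf_mem h k
  upward h k := G.upward (f.monotone h) k

/-- The join of two deductive filters. -/
def join (F G : DeductiveFilter A) : DeductiveFilter A where
  carrier := {x | ∃ p ∈ F.carrier, ∃ q ∈ G.carrier, p * q ≤ x}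
  one_mem := ⟨1, F.one_mem, 1, G.one_mem, (mul_one 1).le⟩
  mul_mem := by
    rintro x y ⟨p, hp, q, hq, h⟩ ⟨p', hp', q', hq', h'⟩
    refine ⟨p * p', F.mul_mem hp hp', q * q', G.mul_mem hq hq', ?_⟩
    rw [mul_mul_mul_comm]
    exact mul_le_mul_of_le h h'
  inf_mem := by
    rintro x y ⟨p, hp, q, hq, h⟩ ⟨p', hp', q', hq', h'⟩
    exact ⟨p ⊓ p', F.inf_mem hp hp', q ⊓ q', G.inf_mem hq hq',
      le_inf ((mul_le_mul_of_le inf_le_left inf_le_left).trans h)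
        ((mul_le_mul_of_le inf_le_right inf_le_right).trans h')⟩
  upward := by
    rintro x y hxy ⟨p, hp, q, hq, h⟩
    exact ⟨p, hp, q, hq, h.trans hxy⟩

theorem mem_join_left {F G : DeductiveFilter A} {x : A} (hx : x ∈ F.carrier) :
    x ∈ (join F G).carrier := ⟨x, hx, 1, G.one_mem, (mul_one x).le⟩

theorem mem_join_right {F G : DeductiveFilter A} {x : A} (hx : x ∈ G.carrier) :
    x ∈ (join F G).carrier := ⟨1, F.one_mem, x, hx, (one_mul x).le⟩

/-- Congruences of idempotent residuated lattices permute. -/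
theorem exists_proj_eq_of_join (hA : IsIdempotent A) {F G : DeductiveFilter A} {a a' : A}
    (h : (join F G).proj a = (join F G).proj a') :
    ∃ m, F.proj m = F.proj a ∧ G.proj m = G.proj a' := by
  obtain ⟨⟨p₁, hp₁, q₁, hq₁, h₁⟩, ⟨p₂, hp₂, q₂, hq₂, h₂⟩⟩ := proj_eq_iff.1 h
  set p := p₁ ⊓ p₂ ⊓ 1
  set q := q₁ ⊓ q₂ ⊓ 1
  have hp : F.proj p = 1 :=
    (proj_eq_one inf_le_right).2 (F.inf_mem (F.inf_mem hp₁ hp₂) F.one_mem)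
  have hq : G.proj q = 1 :=
    (proj_eq_one inf_le_right).2 (G.inf_mem (G.inf_mem hq₁ hq₂) G.one_mem)
  have k₁ : a * (p * q) ≤ a' := mul_le_iff_le_res.2 <| (mul_le_mul_of_le
    (inf_le_left.trans inf_le_left) (inf_le_left.trans inf_le_left)).trans h₁
  have k₂ : a' * (p * q) ≤ a := mul_le_iff_le_res.2 <| (mul_le_mul_of_le
    (inf_le_left.trans inf_le_right) (inf_le_left.trans inf_le_right)).trans h₂
  -- Modulo `G` the factor `q` is `1`, and idempotence absorbs the second `p`; hence `p * a` and `p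
  -- * a'` become equal there. Modulo `F` the factor `p` vanishes instead, so the Mal'cev term below
  -- collapses to `a` and to `a'` respectively.
  have aux : ∀ {c c' : A}, c * (p * q) ≤ c' → G.proj (p * c) ≤ G.proj (p * c') := by
    intro c c' hc
    have := G.proj.monotone (mul_le_mul_of_le_right p hc)
    have e : p * (c * (p * q)) = q * (p * c) := by
      calc p * (c * (p * q)) = q * ((p * p) * c) := by ac_rfl
        _ = _ := by rw [hA]
    rwa [e, Hom.apply_mul, hq, one_mul] at this
  refine ⟨malcev (p * a) (p * a') a', ?_, ?_⟩
  · rw [Hom.apply_malcev, Hom.apply_mul, Hom.apply_mul, hp, one_mul, one_mul, malcev_right]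
  · rw [Hom.apply_malcev, le_antisymm (aux k₁) (aux k₂), malcev_left]

end DeductiveFilter

/-! ### Idempotent chains -/

section Chain

variable {X : Type u} [ResiduatedLattice X]

theorem inf_le_mul (hX : IsIdempotent X) (x y : X) : x ⊓ y ≤ x * y :=
  (hX (x ⊓ y)).ge.trans (mul_le_mul_of_le inf_le_left inf_le_right)

variable (hX : IsIdempotent X) (hlin : ∀ x y : X, x ≤ y ∨ y ≤ x)
include hX hlin

/-- For `x ≤ y` idempotence gives `x ≤ x * y ≤ y`. Multiplying `x * y ≤ 1` by `x`, or `1 ≤ x * y` by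
`y`, turns one of these bounds into an equality. -/
theorem mul_eq_or (x y : X) : x * y = x ∨ x * y = y := by
  wlog hxy : x ≤ y generalizing x y
  · rw [mul_comm]
    exact (this y x ((hlin x y).resolve_left hxy)).symm
  have h1 : x ≤ x * y := by simpa [hxy] using inf_le_mul hX x y
  have h2 : x * y ≤ y := by
    simpa [hX y] using mul_le_mul_of_le hxy (le_refl y)
  rcases hlin (x * y) 1 with h | h
  · left
    refine le_antisymm ?_ h1
    have := mul_le_mul_of_le_right x h
    rwa [← mul_assoc, hX, mul_one] at this
  · right
    refine le_antisymm h2 ?_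
    have := mul_le_mul_of_le h (le_refl y)
    rwa [mul_assoc, hX, one_mul] at this

/-- If `y < x`, the residual is `x* ⊓ y`. If `x ≤ y`, it is `y` unless `x ≤ 1` and `x * (x → y) =
x`, when it is `x*`. Thus a subset of a chain containing `1` and closed under `*` is a subalgebra.
-/
theorem res_eq_or (x y : X) : res x y = eStar x ∨ res x y = y := by
  have hle := mul_res_le x y
  by_cases hxy : x ≤ y
  · have hy : y ≤ res x y := by
      rw [← mul_le_iff_le_res]
      rcases mul_eq_or hX hlin x y with h | h <;> rw [h]
      exact hxy
    rcases mul_eq_or hX hlin x (res x y) with h | h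
    · rcases hlin x 1 with hx | hx
      · left
        refine le_antisymm (mul_le_iff_le_res.1 (h.trans_le hx)) (mul_le_iff_le_res.1 ?_)
        have h1 := one_le_eStar hx
        rcases mul_eq_or hX hlin x (eStar x) with k | k
        · exact k.trans_le hxy
        · have : eStar x = 1 := le_antisymm (k ▸ mul_res_le x 1) h1
          rw [this, mul_one]
          exact hxy
      · right
        refine le_antisymm ?_ hy
        calc res x y = 1 * res x y := (one_mul _).symm
          _ ≤ x * res x y := mul_le_mul_of_le hx le_rfl
          _ ≤ y := hle
    · exact Or.inr (le_antisymm (h ▸ hle) hy)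
  · have hyx := (hlin x y).resolve_left hxy
    have h : x * res x y = res x y :=
      (mul_eq_or hX hlin x (res x y)).resolve_left fun h => hxy (h ▸ hle)
    have hy : res x y ≤ y := h ▸ hle
    have hs : res x y ≤ eStar x := by
      rcases hlin (res x y) 1 with k | k
      · exact mul_le_iff_le_res.1 (h.trans_le k)
      · exact absurd (((mul_one x).ge.trans (mul_le_mul_of_le_right x k)).trans hle) hxy
    have hge : eStar x ⊓ y ≤ res x y := by
      rw [← mul_le_iff_le_res]
      rcases mul_eq_or hX hlin x (eStar x ⊓ y) with k | k
      · have hx : x ≤ 1 := k ▸ (mul_le_mul_of_le_right x inf_le_left).trans (mul_res_le x 1)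
        exact (mul_le_right_of_le_one hx).trans inf_le_right
      · exact k.trans_le inf_le_right
    rcases hlin (eStar x) y with k | k
    · exact Or.inl (le_antisymm hs (by simpa [k] using hge))
    · exact Or.inr (le_antisymm hy (by simpa [k] using hge))

end Chain

/-! ### Subalgebras -/

/-- Subuniverses of a residuated lattice. -/
structure Subuniverse (X : Type u) [ResiduatedLattice X] where
  carrier : Set X
  one_mem : 1 ∈ carrier
  mul_mem : ∀ {x y}, x ∈ carrier → y ∈ carrier → x * y ∈ carrier
  res_mem : ∀ {x y}, x ∈ carrier → y ∈ carrier → res x y ∈ carrier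
  inf_mem : ∀ {x y}, x ∈ carrier → y ∈ carrier → x ⊓ y ∈ carrier
  sup_mem : ∀ {x y}, x ∈ carrier → y ∈ carrier → x ⊔ y ∈ carrier

namespace Subuniverse

variable {X : Type u} [ResiduatedLattice X] (S : Subuniverse X)

instance : ResiduatedLattice S.carrier where
  mul x y := ⟨x.1 * y.1, S.mul_mem x.2 y.2⟩
  one := ⟨1, S.one_mem⟩
  mul_assoc x y z := Subtype.ext (mul_assoc x.1 y.1 z.1)
  one_mul x := Subtype.ext (one_mul x.1)
  mul_one x := Subtype.ext (mul_one x.1)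
  mul_comm x y := Subtype.ext (mul_comm x.1 y.1)
  inf x y := ⟨x.1 ⊓ y.1, S.inf_mem x.2 y.2⟩
  sup x y := ⟨x.1 ⊔ y.1, S.sup_mem x.2 y.2⟩
  inf_le_left x y := (inf_le_left : x.1 ⊓ y.1 ≤ x.1)
  inf_le_right x y := (inf_le_right : x.1 ⊓ y.1 ≤ y.1)
  le_inf x y z h k := (le_inf h k : x.1 ≤ y.1 ⊓ z.1)
  le_sup_left x y := (le_sup_left : x.1 ≤ x.1 ⊔ y.1)
  le_sup_right x y := (le_sup_right : y.1 ≤ x.1 ⊔ y.1)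
  sup_le x y z h k := (sup_le h k : x.1 ⊔ y.1 ≤ z.1)
  res x y := ⟨res x.1 y.1, S.res_mem x.2 y.2⟩
  residuation x y z := residuation x.1 y.1 z.1

/-- The inclusion of a subuniverse. -/
def incl : Hom S.carrier X where
  toFun := Subtype.val
  map_one := rfl
  map_mul _ _ := rfl
  map_res _ _ := rfl
  map_inf _ _ := rfl
  map_sup _ _ := rfl

end Subuniverse

/-! ### The totally ordered case -/

/-- Non-surjective homomorphisms into totally ordered generalized Sugihara monoids are not epic. -/
theorem exists_hom_ne_of_chain {A X : Type u} [ResiduatedLattice A] [ResiduatedLattice X]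
    (hX : IsIdempotent X) (hlin : ∀ x y : X, x ≤ y ∨ y ≤ x)
    (hss : ∀ x : X, eStar (eStar (x ⊔ 1)) = x ⊔ 1) (k : Hom A X)
    (hk : ¬ Function.Surjective k) :
    ∃ (F : DeductiveFilter X) (g h : Hom X F.Quot), (∀ a, g (k a) = h (k a)) ∧ g ≠ h := by
  have hpos : ∀ x : X, 1 ≤ x → eStar (eStar x) = x := fun x hx => by
    simpa [sup_eq_left.2 hx] using hss x
  -- A missing element `b ≥ 1` is replaced by `b*`: if `b* = k a`, then `b = b** = k (a*)`.
  obtain ⟨b, hb, hbk⟩ : ∃ b : X, b < 1 ∧ ∀ a, k a ≠ b := by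
    obtain ⟨b, hb⟩ := not_forall.1 hk
    have hb' : ∀ a, k a ≠ b := fun a h => hb ⟨a, h⟩
    rcases hlin b 1 with h | h
    · exact ⟨b, lt_of_le_of_ne h fun e => hb' 1 (by simp [e]), hb'⟩
    · have hs : ∀ a, k a ≠ eStar b := fun a e => hb' (eStar a) (by simp [e, hpos b h])
      exact ⟨eStar b, lt_of_le_of_ne (eStar_le_one h) fun e => hs 1 (by simp [e]), hs⟩
  have hlt : ∀ x y : X, ¬ x ≤ y → y < x := fun x y h =>
    lt_of_le_not_ge ((hlin x y).resolve_left h) h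
  have inf_or : ∀ x y : X, x ⊓ y = x ∨ x ⊓ y = y := fun x y =>
    (hlin x y).imp inf_eq_left.2 inf_eq_right.2
  have sup_or : ∀ x y : X, x ⊔ y = x ∨ x ⊔ y = y := fun x y =>
    (hlin y x).imp sup_eq_left.2 sup_eq_right.2
  have inf_ind : ∀ (p : X → Prop) {x y : X}, p x → p y → p (x ⊓ y) := fun p x y hx hy => by
    rcases inf_or x y with h | h <;> rwa [h]
  have mul_ind : ∀ (p : X → Prop) {x y : X}, p x → p y → p (x * y) := fun p x y hx hy => by
    rcases mul_eq_or hX hlin x y with h | h <;> rwa [h]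
  -- `F` is the least and `G` the greatest up-set with its trace on the range: the range elements
  -- above the cut at `b`. They differ at `b`.
  let F : DeductiveFilter X :=
    { carrier := {x | ∃ a, b < k a ∧ k a ≤ x}
      one_mem := ⟨1, by simpa using hb, by simp⟩
      mul_mem := fun hx hy => mul_ind (fun z => ∃ a, b < k a ∧ k a ≤ z) hx hy
      inf_mem := fun hx hy => inf_ind (fun z => ∃ a, b < k a ∧ k a ≤ z) hx hy
      upward := fun h ⟨a, h1, h2⟩ => ⟨a, h1, h2.trans h⟩ }
  let G : DeductiveFilter X :=
    { carrier := {x | ∀ a, k a < b → k a < x}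
      one_mem := fun a h => h.trans hb
      mul_mem := fun hx hy => mul_ind (fun z => ∀ a, k a < b → k a < z) hx hy
      inf_mem := fun hx hy => inf_ind (fun z => ∀ a, k a < b → k a < z) hx hy
      upward := fun h h1 a ha => (h1 a ha).trans_le h }
  have hkG : ∀ a, k a ∈ G.carrier → k a ∈ F.carrier := fun a ha => by
    refine ⟨a, hlt _ _ fun h => ?_, le_rfl⟩
    exact lt_irrefl _ (ha a (lt_of_le_of_ne h (hbk a)))
  have hbF : b ∉ F.carrier := fun ⟨a, h1, h2⟩ => not_le_of_gt h1 h2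
  have hbG : b ∈ G.carrier := fun a h => h
  -- The subalgebra of all `x` satisfying `p` contains the range, is large enough to map onto `X/G`,
  -- and does not see the difference between `F` and `G`. So `X/F` receives a map from `X/G`.
  let p : X → Prop := fun x => x ∈ G.carrier → eStar x ∈ G.carrier →
    x ∈ F.carrier ∧ eStar x ∈ F.carrier
  have p_star : ∀ x, p x → p (eStar x) := by
    intro x hx (h1 : eStar x ∈ G.carrier) h2
    rcases hlin x 1 with hx1 | hx1
    · refine ⟨F.mem_of_one_le (one_le_eStar hx1), ?_⟩
      by_cases hxG : x ∈ G.carrier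
      · exact F.upward (le_eStar_eStar x) (hx hxG h1).1
      -- Some range element satisfies `x ≤ k a < b`, while `k a < x**` since `x** ∈ G`. Hence `x** =
      -- (k a)**` lies in the range, where `G` and `F` agree.
      · obtain ⟨a, ha⟩ := not_forall.1 hxG
        obtain ⟨hab, hax⟩ := Classical.not_imp.1 ha
        have hxa : x ≤ k a := by
          by_contra h
          exact hax (hlt _ _ h)
        have hle : eStar (eStar x) ≤ eStar (eStar (k a)) := eStar_anti (eStar_anti hxa)
        have hge : eStar (eStar (k a)) ≤ eStar (eStar x) :=
          (eStar_anti (eStar_anti (h2 a hab).le)).trans_eq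
            (congrArg eStar (hpos _ (one_le_eStar hx1)))
        rw [le_antisymm hle hge] at h2 ⊢
        simp only [← Hom.apply_eStar] at h2 ⊢
        exact hkG _ h2
    · rw [hpos x hx1] at h2 ⊢
      exact (hx h2 h1).symm
  obtain ⟨S, hS⟩ : ∃ S : Subuniverse X, ∀ x, x ∈ S.carrier ↔ p x := by
    refine ⟨⟨{x | p x}, fun _ _ => ⟨F.one_mem, F.mem_of_one_le (one_le_eStar le_rfl)⟩,
      mul_ind p, fun {x y} hx hy => ?_, inf_ind p, fun {x y} hx hy => ?_⟩, fun _ => Iff.rfl⟩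
    · rcases res_eq_or hX hlin x y with h | h <;> rw [h]
      exacts [p_star x hx, hy]
    · rcases sup_or x y with h | h <;> rwa [h]
  have hkS : ∀ a, k a ∈ S.carrier := fun a => (hS _).2 fun h1 h2 => by
    rw [← Hom.apply_eStar] at h2 ⊢
    exact ⟨hkG _ h1, hkG _ h2⟩
  have hsurj : Function.Surjective (G.proj.comp S.incl) := by
    intro y
    obtain ⟨x, rfl⟩ := G.proj_surjective y
    -- An element outside `S` has both `x` and `x*` in `G`, so it is congruent to `1`.
    by_cases hx : x ∈ G.carrier ∧ eStar x ∈ G.carrier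
    · refine ⟨1, ?_⟩
      rw [Hom.apply_one, eq_comm, ← G.proj.apply_one, DeductiveFilter.proj_eq_iff, one_res]
      exact ⟨hx.2, hx.1⟩
    · exact ⟨⟨x, (hS x).2 fun h1 h2 => (hx ⟨h1, h2⟩).elim⟩, rfl⟩
  have hker : ∀ s t, G.proj.comp S.incl s = G.proj.comp S.incl t →
      F.proj.comp S.incl s = F.proj.comp S.incl t := by
    rintro s t h
    obtain ⟨h1, h2⟩ := DeductiveFilter.proj_eq_iff.1 h
    -- This negative element of `S` encodes the congruence of `s` and `t`; its star is above `1`, so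
    -- `p` carries it from `G` to `F`.
    have hu := S.inf_mem (S.inf_mem (S.res_mem s.2 t.2) (S.res_mem t.2 s.2)) S.one_mem
    have := ((hS _).1 hu (G.inf_mem (G.inf_mem h1 h2) G.one_mem)
      (G.mem_of_one_le (one_le_eStar inf_le_right))).1
    exact DeductiveFilter.proj_eq_iff.2 ⟨F.upward (inf_le_left.trans inf_le_left) this,
      F.upward (inf_le_left.trans inf_le_right) this⟩
  obtain ⟨h, hh⟩ := Hom.exists_factor _ hsurj _ hker
  refine ⟨F, F.proj, h.comp G.proj, fun a => (hh ⟨k a, hkS a⟩).symm, fun e => hbF ?_⟩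
  have := DFunLike.congr_fun e b
  rw [Hom.comp_apply, (DeductiveFilter.proj_eq_one hb.le).2 hbG, Hom.apply_one] at this
  exact (DeductiveFilter.proj_eq_one hb.le).1 this

/-! ### Merging two approximations -/

/-- If `f` becomes surjective modulo two deductive filters and is an epimorphism with respect to
the quotients of its domain, then its range is closed under simultaneous approximation. -/
theorem exists_proj_eq_of_surjective {A B : Type u} [ResiduatedLattice A] [ResiduatedLattice B]
    (hA : IsIdempotent A) (f : Hom A B)
    (hf : ∀ (R : DeductiveFilter A) (g h : Hom B R.Quot), (∀ a, g (f a) = h (f a)) → g = h)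
    (P Q : DeductiveFilter B) (hP : Function.Surjective (P.proj.comp f))
    (hQ : Function.Surjective (Q.proj.comp f)) (b : B) :
    ∃ a, P.proj (f a) = P.proj b ∧ Q.proj (f a) = Q.proj b := by
  let P' := P.comap f
  let Q' := Q.comap f
  let R := P'.join Q'
  have key : ∀ (T : DeductiveFilter B), (∀ x, x ∈ (T.comap f).carrier → x ∈ R.carrier) →
      ∀ x y, T.proj.comp f x = T.proj.comp f y → R.proj x = R.proj y := by
    intro T hT x y h
    obtain ⟨h1, h2⟩ := DeductiveFilter.proj_eq_iff.1 h
    rw [← Hom.apply_res] at h1 h2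
    exact DeductiveFilter.proj_eq_iff.2 ⟨hT _ h1, hT _ h2⟩
  have pull : ∀ (T : DeductiveFilter B) {x y : A}, (T.comap f).proj x = (T.comap f).proj y →
      T.proj (f x) = T.proj (f y) := by
    intro T x y h
    obtain ⟨h1, h2⟩ := DeductiveFilter.proj_eq_iff.1 h
    refine DeductiveFilter.proj_eq_iff.2 ?_
    rw [← Hom.apply_res, ← Hom.apply_res]
    exact ⟨h1, h2⟩
  -- Surjectivity identifies `B/P` with `A/P'` and `B/Q` with `A/Q'`, so both map onto `A/R`. The
  -- two resulting maps from `B` restrict along `f` to `R.proj`.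
  obtain ⟨g, hg⟩ := Hom.exists_factor _ hP R.proj
    (key P fun _ => DeductiveFilter.mem_join_left)
  obtain ⟨h, hh⟩ := Hom.exists_factor _ hQ R.proj
    (key Q fun _ => DeductiveFilter.mem_join_right)
  have heq := hf R (g.comp P.proj) (h.comp Q.proj) fun a => (hg a).trans (hh a).symm
  obtain ⟨a, ha⟩ := hP (P.proj b)
  obtain ⟨a', ha'⟩ := hQ (Q.proj b)
  have e := DFunLike.congr_fun heq b
  rw [Hom.comp_apply, Hom.comp_apply, ← ha, ← ha', hg, hh] at e
  obtain ⟨m, hm, hm'⟩ := DeductiveFilter.exists_proj_eq_of_join hA e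
  exact ⟨m, (pull P hm).trans ha, (pull Q hm').trans ha'⟩

/-! ### Prime filters and separation -/

/-- Prime lattice filters, not necessarily proper or nonempty. -/
structure IsPrimeFilter {B : Type u} [Lattice B] (U : Set B) : Prop where
  upward : ∀ {x y}, x ≤ y → x ∈ U → y ∈ U
  inf_mem : ∀ {x y}, x ∈ U → y ∈ U → x ⊓ y ∈ U
  mem_or_mem : ∀ {x y}, x ⊔ y ∈ U → x ∈ U ∨ y ∈ U

theorem IsPrimeFilter.compl_ideal {B : Type u} [DistribLattice B] {J : Order.Ideal B}
    (hJ : J.IsPrime) : IsPrimeFilter ((J : Set B)ᶜ) where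
  upward h hx hy := hx (J.lower h hy)
  inf_mem hx hy h := (hJ.mem_or_mem h).elim hx hy
  mem_or_mem {x y} h := by
    by_contra! hc
    exact h (J.sup_mem (not_not.1 hc.1) (not_not.1 hc.2))

/-- Elements outside a sublattice of a distributive lattice are separated from it by two prime
filters. -/
theorem exists_isPrimeFilter_of_notMem {B : Type u} [DistribLattice B] {A : Set B}
    (hinf : ∀ x ∈ A, ∀ y ∈ A, x ⊓ y ∈ A) (hsup : ∀ x ∈ A, ∀ y ∈ A, x ⊔ y ∈ A) {b : B}
    (hb : b ∉ A) :
    ∃ U V : Set B, IsPrimeFilter U ∧ IsPrimeFilter V ∧ b ∈ U ∧ b ∉ V ∧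
      ∀ a ∈ A, a ∈ U → a ∈ V := by
  obtain ⟨U, hU, hbU, hUA⟩ : ∃ U : Set B, IsPrimeFilter U ∧ b ∈ U ∧
      ∀ a ∈ A, a ∈ U → ¬ a ≤ b := by
    by_cases hne : ∃ a ∈ A, a ≤ b
    · let I : Order.Ideal B :=
        { carrier := {x | ∃ a ∈ A, a ≤ b ∧ x ≤ a}
          lower' := fun x y hyx ⟨a, ha, hab, hxa⟩ => ⟨a, ha, hab, hyx.trans hxa⟩
          nonempty' := let ⟨a, ha, hab⟩ := hne; ⟨a, a, ha, hab, le_rfl⟩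
          directed' := fun x ⟨a, ha, hab, hxa⟩ y ⟨a', ha', hab', hya⟩ =>
            ⟨a ⊔ a', ⟨a ⊔ a', hsup a ha a' ha', sup_le hab hab', le_rfl⟩,
              hxa.trans le_sup_left, hya.trans le_sup_right⟩ }
      have hd : Disjoint ((Order.PFilter.principal b : Order.PFilter B) : Set B) I := by
        refine Set.disjoint_left.2 fun x hx hx' => ?_
        obtain ⟨a, ha, hab, hxa⟩ := hx'
        have hbx : b ≤ x := hx
        exact hb (le_antisymm hab (hbx.trans hxa) ▸ ha)
      obtain ⟨J, hJ, hIJ, hFJ⟩ := DistribLattice.prime_ideal_of_disjoint_filter_ideal hd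
      exact ⟨_, IsPrimeFilter.compl_ideal hJ, Set.disjoint_left.1 hFJ (le_refl b),
        fun a ha haJ hab => haJ (hIJ ⟨a, ha, hab, le_rfl⟩)⟩
    · exact ⟨Set.univ, ⟨fun _ _ => trivial, fun _ _ => trivial, fun _ => Or.inl trivial⟩, trivial,
        fun a ha _ hab => hne ⟨a, ha, hab⟩⟩
  -- No member of `A ∩ U` is below `b`, so the filter generated by `A ∩ U` extends to a prime filter
  -- omitting `b`; if `A ∩ U` is empty, `∅` serves.
  by_cases hne : ∃ a ∈ A, a ∈ U
  · let F : Order.PFilter B := Order.IsPFilter.toPFilter (F := {x | ∃ a ∈ A, a ∈ U ∧ a ≤ x}) <|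
      Order.IsPFilter.of_def (let ⟨a, ha, hab⟩ := hne; ⟨a, a, ha, hab, le_rfl⟩)
        (fun x ⟨a, ha, hab, hxa⟩ y ⟨a', ha', hab', hya⟩ =>
          ⟨a ⊓ a', ⟨a ⊓ a', hinf a ha a' ha', hU.inf_mem hab hab', le_rfl⟩,
            inf_le_left.trans hxa, inf_le_right.trans hya⟩)
        (fun {x y} hxy ⟨a, ha, hab, hxa⟩ => ⟨a, ha, hab, hxa.trans hxy⟩)
    have hd : Disjoint (F : Set B) (Order.Ideal.principal b : Order.Ideal B) := by
      refine Set.disjoint_left.2 fun x hx hx' => ?_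
      obtain ⟨a, ha, haU, hax⟩ := hx
      exact hUA a ha haU (hax.trans hx')
    obtain ⟨J, hJ, hIJ, hFJ⟩ := DistribLattice.prime_ideal_of_disjoint_filter_ideal hd
    exact ⟨U, _, hU, IsPrimeFilter.compl_ideal hJ, hbU, fun h => h (hIJ (le_refl b)),
      fun a ha haU => Set.disjoint_left.1 hFJ ⟨a, ha, haU, le_rfl⟩⟩
  · exact ⟨U, ∅, hU, ⟨fun _ h => h, fun h _ => h, fun h => Or.inl h⟩, hbU, fun h => h,
      fun a ha haU => hne ⟨a, ha, haU⟩⟩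

/-! ### Stabilizers of prime filters -/

section Stabilizer

variable {B : Type u} [ResiduatedLattice B] {U : Set B}

/-- The deductive filter of all elements whose negative part stabilizes a prime filter. -/
def IsPrimeFilter.stabilizer (hU : IsPrimeFilter U) : DeductiveFilter B :=
  have hmul : ∀ {x y z : B}, (x ⊓ 1) * (y ⊓ 1) ≤ z → (∀ u ∈ U, (x ⊓ 1) * u ∈ U) →
      (∀ u ∈ U, (y ⊓ 1) * u ∈ U) → ∀ u ∈ U, (z ⊓ 1) * u ∈ U := by
    intro x y z h hx hy u hu
    refine hU.upward ?_ (hx _ (hy u hu))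
    rw [← mul_assoc]
    exact mul_le_mul_of_le (le_inf h
      ((mul_le_left_of_le_one inf_le_right).trans inf_le_right)) le_rfl
  { carrier := {x | ∀ u ∈ U, (x ⊓ 1) * u ∈ U}
    one_mem := by simp
    mul_mem := hmul (mul_le_mul_of_le inf_le_left inf_le_left)
    inf_mem := hmul (inf_one_mul_inf_one_le _ _)
    upward := fun h hx u hu =>
      hU.upward (mul_le_mul_of_le (inf_le_inf_right 1 h) le_rfl) (hx u hu) }

theorem IsPrimeFilter.mem_of_proj_eq (hU : IsPrimeFilter U) {x y : B}
    (h : hU.stabilizer.proj x = hU.stabilizer.proj y) (hx : x ∈ U) : y ∈ U := by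
  refine hU.upward ?_ ((DeductiveFilter.proj_eq_iff.1 h).1 x hx)
  rw [mul_comm]
  exact (mul_le_mul_of_le_right x inf_le_left).trans (mul_res_le x y)

theorem IsPrimeFilter.stabilizer_quot_total (hU : IsPrimeFilter U)
    (hB : ∀ x y : B, (res x y ⊓ 1) ⊔ (res y x ⊓ 1) = 1) (x y : hU.stabilizer.Quot) :
    x ≤ y ∨ y ≤ x := by
  obtain ⟨x, rfl⟩ := DeductiveFilter.proj_surjective x
  obtain ⟨y, rfl⟩ := DeductiveFilter.proj_surjective y
  rw [DeductiveFilter.proj_le_iff, DeductiveFilter.proj_le_iff]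
  by_contra! hc
  obtain ⟨h1, h2⟩ := hc
  obtain ⟨u, hu⟩ := not_forall.1 h1
  obtain ⟨v, hv⟩ := not_forall.1 h2
  obtain ⟨hu, hu'⟩ := Classical.not_imp.1 hu
  obtain ⟨hv, hv'⟩ := Classical.not_imp.1 hv
  have hw := hU.inf_mem hu hv
  -- Prelinearity writes `u ⊓ v` as the join of its products with the two negative residuals;
  -- primeness puts one of them in `U`.
  rw [← one_mul (u ⊓ v), ← hB x y, mul_comm, mul_sup_distrib] at hw
  rcases hU.mem_or_mem hw with h | h
  · exact hu' (hU.upward (mul_comm (u ⊓ v) _ ▸ mul_le_mul_of_le_right _ inf_le_left) h)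
  · exact hv' (hU.upward (mul_comm (u ⊓ v) _ ▸ mul_le_mul_of_le_right _ inf_le_right) h)

end Stabilizer

/-! ### Consequences of semilinearity -/

section Semilinear

variable {B : Type u} [ResiduatedLattice B]

/-- Identities that hold in all totally ordered algebras hold in semilinear ones. -/
theorem IsSemilinear.exists_separating (hB : IsSemilinear B) {x y : B}
    (h : ∀ (C : Type u) [ResiduatedLattice C], (∀ x y : C, x ≤ y ∨ y ≤ x) →
      ∀ φ : Hom B C, φ x = φ y) : x = y := by
  obtain ⟨ι, C, inst, hlin, φ, hφ, -⟩ := hB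
  refine hφ (funext fun i => ?_)
  let ψ : Hom B (C i) :=
    { toFun := fun a => φ a i
      map_one := by rw [φ.apply_one]; rfl
      map_mul := fun x y => by rw [φ.apply_mul]; rfl
      map_res := fun x y => by rw [φ.apply_res]; rfl
      map_inf := fun x y => by rw [φ.apply_inf]; rfl
      map_sup := fun x y => by rw [φ.apply_sup]; rfl }
  exact h (C i) (hlin i) ψ

theorem IsSemilinear.prelinear (hB : IsSemilinear B) (x y : B) :
    (res x y ⊓ 1) ⊔ (res y x ⊓ 1) = 1 := by
  refine hB.exists_separating fun C _ hC φ => ?_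
  simp only [Hom.apply_sup, Hom.apply_inf, Hom.apply_res, Hom.apply_one]
  rcases hC (φ x) (φ y) with h | h
  · rw [inf_eq_right.2 (one_le_res_iff.2 h), sup_eq_left.2 inf_le_right]
  · rw [inf_eq_right.2 (one_le_res_iff.2 h), sup_eq_right.2 inf_le_right]

theorem IsSemilinear.le_sup_inf (hB : IsSemilinear B) (x y z : B) :
    (x ⊔ y) ⊓ (x ⊔ z) ≤ x ⊔ y ⊓ z := by
  rw [← inf_eq_left]
  refine hB.exists_separating fun C _ hC φ => ?_
  simp only [Hom.apply_sup, Hom.apply_inf]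
  rw [inf_eq_left]
  rcases hC (φ y) (φ z) with h | h
  · rw [inf_eq_left.2 h]
    exact inf_le_left
  · rw [inf_eq_right.2 h]
    exact inf_le_right

end Semilinear

end ResiduatedLattice

/-! ### Assembling the theorem -/

open ResiduatedLattice in
theorem RL.surjective_proj_comp {K : Set RL.{u}} (hK : RL.IsVariety K) (hGSM : K ⊆ RL.GSM)
    {A B : RL.{u}} (hB : B ∈ K) {f : RL.Hom A B} (hf : RL.IsEpi K f)
    (P : DeductiveFilter B.carrier) (hP : ∀ x y : P.Quot, x ≤ y ∨ y ≤ x) :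
    Function.Surjective (P.proj.comp f) := by
  have hX : RL.mk P.Quot ∈ K := hK.homImage (B := RL.mk P.Quot) P.proj P.proj_surjective hB
  by_contra hns
  obtain ⟨F, g, h, hgh, hne⟩ := exists_hom_ne_of_chain (hGSM hX).idempotent hP
    (hGSM hX).star_star (P.proj.comp f) hns
  have hC : RL.mk F.Quot ∈ K :=
    hK.homImage (A := RL.mk P.Quot) (B := RL.mk F.Quot) F.proj F.proj_surjective hX
  have e := hf _ hC (g.comp P.proj) (h.comp P.proj) hgh
  refine hne (Hom.ext fun x => ?_)
  obtain ⟨b, rfl⟩ := P.proj_surjective x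
  exact DFunLike.congr_fun e b

open ResiduatedLattice in
theorem mainTheorem4 (K : Set RL.{u}) (hK : RL.IsVariety K) (hGSM : K ⊆ RL.GSM) :
    RL.HasES K := by
  intro A hA B hB f hf
  by_contra hns
  obtain ⟨b, hb⟩ := not_forall.1 hns
  have hs := (hGSM hB).semilinear
  let _ : DistribLattice B.carrier := { (inferInstance : Lattice B.carrier) with
    le_sup_inf := hs.le_sup_inf }
  obtain ⟨U, V, hU, hV, hbU, hbV, hUV⟩ := exists_isPrimeFilter_of_notMem (A := Set.range f)
    (by rintro _ ⟨x, rfl⟩ _ ⟨y, rfl⟩; exact ⟨x ⊓ y, f.apply_inf x y⟩)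
    (by rintro _ ⟨x, rfl⟩ _ ⟨y, rfl⟩; exact ⟨x ⊔ y, f.apply_sup x y⟩) hb
  obtain ⟨a, haU, haV⟩ := exists_proj_eq_of_surjective (hGSM hA).idempotent f
    (fun R g h => hf (RL.mk R.Quot)
      (hK.homImage (B := RL.mk R.Quot) R.proj R.proj_surjective hA) g h)
    hU.stabilizer hV.stabilizer
    (RL.surjective_proj_comp hK hGSM hB hf _ (hU.stabilizer_quot_total hs.prelinear))
    (RL.surjective_proj_comp hK hGSM hB hf _ (hV.stabilizer_quot_total hs.prelinear)) b
  exact hbV (hV.mem_of_proj_eq haV (hUV _ ⟨a, rfl⟩ (hU.mem_of_proj_eq haU.symm hbU)))
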